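/- Let $q\in(0,1)$ and let $Y\subset(q,1)$ be a non-empty compact set with maximum $s$. Let $\{I_j : j\in J\}$ be the family of connected components of $(q,s]\setminus Y$, indexed without repetition. Write $C(Y)$ for the C*-algebra of continuous complex-valued functions on $Y$, and $\chi_{(a,b)}$ for the function equal to $1$ on $(a,b)$ and $0$ elsewhere; for $a,b\notin Y$ its restriction to $Y$ is a projection in $C(Y)$. Then $$K_1(C(Y))=0 .$$ If $Y$ has exactly $n\in\mathbb{N}$ connected components, then $K_0(C(Y))\cong\mathbb{Z}^n$. If $Y$ has infinitely many connected components, then $K_0(C(Y))\cong\bigoplus_{k\in\mathbb{N}}\mathbb{Z}$. Moreover, for every choice of real numbers $c_j\in I_j$ $(j\in J)$, the classes $[\chi_{(c_j,1)}]$, $j\in J$, of the projections $\chi_{(c_j,1)}\in C(Y)$ generate $K_0(C(Y))$ freely, that is, they form a $\mathbb{Z}$-basis of $K_0(C(Y))$ indexed by $J$. -/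

import Mathlib

open Matrix

noncomputable section

namespace KTheory

section Matrices

variable {A : Type*} [Ring A] [StarRing A]

/-- Murray-von Neumann equivalence of two square matrices over `A`, possibly of different sizes:
`p = v v*` and `q = v* v` for some rectangular matrix `v` over `A`. -/
def MvN {m n : Type*} [Fintype m] [Fintype n] (p : Matrix m m A) (q : Matrix n n A) : Prop :=
  ∃ v : Matrix m n A, v * vᴴ = p ∧ vᴴ * v = q

theorem MvN.symm {m n : Type*} [Fintype m] [Fintype n] {p : Matrix m m A} {q : Matrix n n A}
    (h : MvN p q) : MvN q p := by
  obtain ⟨v, h1, h2⟩ := h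
  exact ⟨vᴴ, by rw [conjTranspose_conjTranspose, h2], by rw [conjTranspose_conjTranspose, h1]⟩

theorem MvN.trans {l m n : Type*} [Fintype l] [Fintype m] [Fintype n]
    {p : Matrix l l A} {q : Matrix m m A} {r : Matrix n n A}
    (hp : p * p = p) (hr : r * r = r) (h : MvN p q) (h' : MvN q r) : MvN p r := by
  obtain ⟨v, h1, h2⟩ := h
  obtain ⟨w, h3, h4⟩ := h'
  refine ⟨v * w, ?_, ?_⟩
  · calc v * w * (v * w)ᴴ = v * (w * wᴴ) * vᴴ := by
          simp only [conjTranspose_mul, Matrix.mul_assoc]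
      _ = (v * vᴴ) * (v * vᴴ) := by rw [h3, ← h2]; simp only [Matrix.mul_assoc]
      _ = p := by rw [h1, hp]
  · calc (v * w)ᴴ * (v * w) = wᴴ * (vᴴ * v) * w := by
          simp only [conjTranspose_mul, Matrix.mul_assoc]
      _ = (wᴴ * w) * (wᴴ * w) := by rw [h2, ← h3]; simp only [Matrix.mul_assoc]
      _ = r := by rw [h4, hr]

theorem MvN.submatrix {m n : Type*} [Fintype m] [Fintype n] {p : Matrix m m A}
    (hp : IsStarProjection p) (e : n ≃ m) : MvN (p.submatrix e e) p := by
  have h1 : p * p = p := hp.isIdempotentElem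
  have h2 : pᴴ = p := hp.isSelfAdjoint
  refine ⟨p.submatrix e (Equiv.refl m), ?_, ?_⟩
  · rw [conjTranspose_submatrix, submatrix_mul_equiv, h2, h1]
  · rw [conjTranspose_submatrix, submatrix_mul_equiv, h2, h1]
    rfl

theorem MvN.refl {m : Type*} [Fintype m] {p : Matrix m m A} (hp : IsStarProjection p) :
    MvN p p := MvN.submatrix hp (Equiv.refl m)

theorem MvN.blocks {m n m' n' : Type*} [Fintype m] [Fintype n] [Fintype m'] [Fintype n']
    {p : Matrix m m A} {q : Matrix n n A} {p' : Matrix m' m' A} {q' : Matrix n' n' A}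
    (h : MvN p p') (h' : MvN q q') :
    MvN (fromBlocks p 0 0 q) (fromBlocks p' 0 0 q') := by
  obtain ⟨v, h1, h2⟩ := h
  obtain ⟨w, h3, h4⟩ := h'
  exact ⟨fromBlocks v 0 0 w, by simp [fromBlocks_conjTranspose, fromBlocks_multiply, h1, h3],
    by simp [fromBlocks_conjTranspose, fromBlocks_multiply, h2, h4]⟩

theorem isStarProjection_blocks {m n : Type*} [Fintype m] [Fintype n]
    {p : Matrix m m A} {q : Matrix n n A} (hp : IsStarProjection p) (hq : IsStarProjection q) :
    IsStarProjection (fromBlocks p 0 0 q) := by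
  have h1 : p * p = p := hp.isIdempotentElem
  have h2 : pᴴ = p := hp.isSelfAdjoint
  have h3 : q * q = q := hq.isIdempotentElem
  have h4 : qᴴ = q := hq.isSelfAdjoint
  refine ⟨?_, ?_⟩
  · simp [IsIdempotentElem, fromBlocks_multiply, h1, h3]
  · simp [IsSelfAdjoint, star_eq_conjTranspose, fromBlocks_conjTranspose, h2, h4]

/-- The block diagonal sum `diag(a, b)`, as a matrix of size `m + n`. -/
def dirSum {m n : ℕ} (a : Matrix (Fin m) (Fin m) A) (b : Matrix (Fin n) (Fin n) A) :
    Matrix (Fin (m + n)) (Fin (m + n)) A :=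
  (fromBlocks a 0 0 b).submatrix finSumFinEquiv.symm finSumFinEquiv.symm

theorem dirSum_mul {m n : ℕ} (a a' : Matrix (Fin m) (Fin m) A) (b b' : Matrix (Fin n) (Fin n) A) :
    dirSum a b * dirSum a' b' = dirSum (a * a') (b * b') := by
  simp [dirSum, submatrix_mul_equiv, fromBlocks_multiply]

theorem star_dirSum {m n : ℕ} (a : Matrix (Fin m) (Fin m) A) (b : Matrix (Fin n) (Fin n) A) :
    star (dirSum a b) = dirSum (star a) (star b) := by
  simp [dirSum, star_eq_conjTranspose, fromBlocks_conjTranspose]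

theorem dirSum_one {m n : ℕ} :
    dirSum (1 : Matrix (Fin m) (Fin m) A) (1 : Matrix (Fin n) (Fin n) A) = 1 := by
  simp [dirSum]

theorem isStarProjection_dirSum {m n : ℕ} {p : Matrix (Fin m) (Fin m) A}
    {q : Matrix (Fin n) (Fin n) A} (hp : IsStarProjection p) (hq : IsStarProjection q) :
    IsStarProjection (dirSum p q) := by
  refine ⟨?_, ?_⟩
  · change dirSum p q * dirSum p q = dirSum p q
    rw [dirSum_mul, hp.isIdempotentElem.eq, hq.isIdempotentElem.eq]
  · change star (dirSum p q) = dirSum p q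
    rw [star_dirSum, hp.isSelfAdjoint.star_eq, hq.isSelfAdjoint.star_eq]

theorem mvN_dirSum_blocks {m n : ℕ} {p : Matrix (Fin m) (Fin m) A}
    {q : Matrix (Fin n) (Fin n) A} (hp : IsStarProjection p) (hq : IsStarProjection q) :
    MvN (dirSum p q) (fromBlocks p 0 0 q) :=
  MvN.submatrix (isStarProjection_blocks hp hq) _

end Matrices

section KZero

variable (A : Type*) [Ring A] [StarRing A]

/-- A projection in some matrix algebra `Mat_n(A)`. -/
structure ProjMat where
  /-- the size of the matrix -/
  size : ℕ
  /-- the matrix -/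
  mat : Matrix (Fin size) (Fin size) A
  isProj : IsStarProjection mat

/-- Murray-von Neumann equivalence on the projections of all sizes. -/
instance ProjMat.setoid : Setoid (ProjMat A) where
  r p q := MvN p.mat q.mat
  iseqv :=
    { refl := fun p => MvN.refl p.isProj
      symm := fun h => h.symm
      trans := fun {p _ r} h h' =>
        h.trans p.isProj.isIdempotentElem.eq r.isProj.isIdempotentElem.eq h' }

variable {A} in
/-- The direct sum of projections. -/
def ProjMat.add (p q : ProjMat A) : ProjMat A :=
  ⟨p.size + q.size, dirSum p.mat q.mat, isStarProjection_dirSum p.isProj q.isProj⟩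

variable {A} in
theorem ProjMat.add_congr {p p' q q' : ProjMat A} (h : MvN p.mat p'.mat)
    (h' : MvN q.mat q'.mat) : MvN (p.add q).mat (p'.add q').mat :=
  have i := (p.add q).isProj.isIdempotentElem.eq
  have i' := (p'.add q').isProj.isIdempotentElem.eq
  have b := (isStarProjection_blocks p'.isProj q'.isProj).isIdempotentElem.eq
  ((mvN_dirSum_blocks p.isProj q.isProj).trans i b (h.blocks h')).trans i i'
    (mvN_dirSum_blocks p'.isProj q'.isProj).symm

variable {A} in
theorem ProjMat.add_comm' (p q : ProjMat A) : MvN (p.add q).mat (q.add p).mat := by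
  have b := isStarProjection_blocks p.isProj q.isProj
  have b' := isStarProjection_blocks q.isProj p.isProj
  have i := (p.add q).isProj.isIdempotentElem.eq
  have i' := (q.add p).isProj.isIdempotentElem.eq
  have h := MvN.submatrix b (Equiv.sumComm (Fin q.size) (Fin p.size))
  have e : (fromBlocks p.mat 0 0 q.mat).submatrix (Equiv.sumComm (Fin q.size) (Fin p.size))
      (Equiv.sumComm (Fin q.size) (Fin p.size)) = fromBlocks q.mat 0 0 p.mat := by
    ext (x | x) (y | y) <;> rfl
  rw [e] at h
  exact ((mvN_dirSum_blocks p.isProj q.isProj).trans i b'.isIdempotentElem.eq h.symm).trans i i'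
    (mvN_dirSum_blocks q.isProj p.isProj).symm

variable {A} in
theorem ProjMat.add_assoc' (p q r : ProjMat A) :
    MvN ((p.add q).add r).mat (p.add (q.add r)).mat := by
  have i := ((p.add q).add r).isProj.isIdempotentElem.eq
  have i' := (p.add (q.add r)).isProj.isIdempotentElem.eq
  have b := isStarProjection_blocks (isStarProjection_blocks p.isProj q.isProj) r.isProj
  have b' := isStarProjection_blocks p.isProj (isStarProjection_blocks q.isProj r.isProj)
  have h1 : MvN ((p.add q).add r).mat (fromBlocks (fromBlocks p.mat 0 0 q.mat) 0 0 r.mat) :=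
    (mvN_dirSum_blocks (p.add q).isProj r.isProj).trans i b.isIdempotentElem.eq
      ((mvN_dirSum_blocks p.isProj q.isProj).blocks (MvN.refl r.isProj))
  have h2 : MvN (p.add (q.add r)).mat (fromBlocks p.mat 0 0 (fromBlocks q.mat 0 0 r.mat)) :=
    (mvN_dirSum_blocks p.isProj (q.add r).isProj).trans i' b'.isIdempotentElem.eq
      ((MvN.refl p.isProj).blocks (mvN_dirSum_blocks q.isProj r.isProj))
  have h3 := MvN.submatrix b' (Equiv.sumAssoc (Fin p.size) (Fin q.size) (Fin r.size))
  have e : (fromBlocks p.mat 0 0 (fromBlocks q.mat 0 0 r.mat)).submatrix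
      (Equiv.sumAssoc (Fin p.size) (Fin q.size) (Fin r.size))
      (Equiv.sumAssoc (Fin p.size) (Fin q.size) (Fin r.size)) =
      fromBlocks (fromBlocks p.mat 0 0 q.mat) 0 0 r.mat := by
    ext ((x | x) | x) ((y | y) | y) <;> rfl
  rw [e] at h3
  exact (h1.trans i b'.isIdempotentElem.eq h3).trans i i' h2.symm

/-- The projection of size zero. -/
def ProjMat.zero : ProjMat A := ⟨0, 0, ⟨by simp [IsIdempotentElem], by simp [IsSelfAdjoint]⟩⟩

variable {A} in
theorem ProjMat.zero_add' (p : ProjMat A) : MvN ((ProjMat.zero A).add p).mat p.mat := by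
  have b := isStarProjection_blocks (ProjMat.zero A).isProj p.isProj
  have i := ((ProjMat.zero A).add p).isProj.isIdempotentElem.eq
  have h := MvN.submatrix b (Equiv.emptySum (Fin 0) (Fin p.size)).symm
  have e : (fromBlocks (ProjMat.zero A).mat 0 0 p.mat).submatrix
      (Equiv.emptySum (Fin 0) (Fin p.size)).symm
      (Equiv.emptySum (Fin 0) (Fin p.size)).symm = p.mat := by
    ext x y; rfl
  have h' : MvN p.mat (fromBlocks (ProjMat.zero A).mat 0 0 p.mat) := e ▸ h
  exact (mvN_dirSum_blocks (ProjMat.zero A).isProj p.isProj).trans i p.isProj.isIdempotentElem.eq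
    h'.symm

/-- The commutative monoid of Murray-von Neumann classes of projections in matrices over `A`. -/
def ProjClass : Type _ := Quotient (ProjMat.setoid A)

instance : Add (ProjClass A) :=
  ⟨Quotient.map₂ ProjMat.add fun _ _ h _ _ h' => ProjMat.add_congr h h'⟩

instance : Zero (ProjClass A) := ⟨Quotient.mk _ (ProjMat.zero A)⟩

instance : AddCommMonoid (ProjClass A) where
  add_assoc := by
    rintro ⟨p⟩ ⟨q⟩ ⟨r⟩
    exact Quotient.sound (ProjMat.add_assoc' p q r)
  zero_add := by
    rintro ⟨p⟩
    exact Quotient.sound (ProjMat.zero_add' p)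
  add_zero := by
    rintro ⟨p⟩
    exact Quotient.sound
      ((ProjMat.add_comm' p (ProjMat.zero A)).trans (p.add _).isProj.isIdempotentElem.eq
        p.isProj.isIdempotentElem.eq (ProjMat.zero_add' p))
  add_comm := by
    rintro ⟨p⟩ ⟨q⟩
    exact Quotient.sound (ProjMat.add_comm' p q)
  nsmul := nsmulRec

/-- `K₀(A)` for a unital C*-algebra `A`: the Grothendieck group of the monoid of Murray-von Neumann
classes of projections in matrix algebras over `A`. -/
def K0 : Type _ := Algebra.GrothendieckAddGroup (ProjClass A)

instance : AddCommGroup (K0 A) :=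
  inferInstanceAs (AddCommGroup (Algebra.GrothendieckAddGroup (ProjClass A)))

variable {A}

/-- The class `[p]` in `K₀(A)` of a projection `p` in some `Mat_n(A)`. -/
def K0.mk (p : ProjMat A) : K0 A :=
  Algebra.GrothendieckAddGroup.of (Quotient.mk (ProjMat.setoid A) p : ProjClass A)

/-- A projection of `A`, as a matrix of size one. -/
def ProjMat.ofElem (p : A) (hp : IsStarProjection p) : ProjMat A where
  size := 1
  mat := Matrix.of fun _ _ => p
  isProj := by
    refine ⟨?_, ?_⟩
    · ext i j
      simpa [Matrix.mul_apply] using hp.isIdempotentElem.eq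
    · ext i j
      simpa [Matrix.star_apply] using hp.isSelfAdjoint.star_eq

end KZero

section KOne

variable (A : Type*) [Ring A] [StarRing A] [TopologicalSpace A]

/-- A unitary in some matrix algebra `Mat_n(A)`. -/
abbrev UnitaryMat : Type _ := Σ n : ℕ, unitary (Matrix (Fin n) (Fin n) A)

variable {A} in
/-- The direct sum of unitaries. -/
def UnitaryMat.add (u v : UnitaryMat A) : UnitaryMat A :=
  ⟨u.1 + v.1, dirSum (u.2 : Matrix (Fin u.1) (Fin u.1) A) (v.2 : Matrix (Fin v.1) (Fin v.1) A), by
    rw [Unitary.mem_iff, star_dirSum, dirSum_mul, dirSum_mul]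
    simp [dirSum_one]⟩

/-- The defining relations of `K₁(A)`: `[1] = 0`; `[u] = [v]` if `u` and `v` have the same size `n`
and are joined by a continuous path of unitaries in `Mat_n(A)` (with the topology of entrywise
convergence, which is the norm topology); `[diag(u, v)] = [u] + [v]`. -/
inductive K1Rel : FreeAbelianGroup (UnitaryMat A) → Prop
  | one (n : ℕ) : K1Rel (FreeAbelianGroup.of ⟨n, 1⟩)
  | path (n : ℕ) (u v : unitary (Matrix (Fin n) (Fin n) A)) (h : Joined u v) :
      K1Rel (FreeAbelianGroup.of ⟨n, u⟩ - FreeAbelianGroup.of ⟨n, v⟩)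
  | add (u v : UnitaryMat A) : K1Rel (FreeAbelianGroup.of (u.add v) -
      (FreeAbelianGroup.of u + FreeAbelianGroup.of v))

/-- `K₁(A)` for a unital C*-algebra `A`: the abelian group with one generator `[u]` for each unitary
matrix `u` over `A`, subject to the relations `K1Rel`. -/
def K1 : Type _ := FreeAbelianGroup (UnitaryMat A) ⧸ AddSubgroup.closure {x | K1Rel A x}

instance : AddCommGroup (K1 A) :=
  inferInstanceAs (AddCommGroup (FreeAbelianGroup (UnitaryMat A) ⧸
    AddSubgroup.closure {x | K1Rel A x}))

end KOne

section Planar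

/-- The connected components of `(q, s] \ Y`, where `s` is the maximum of `Y`. -/
def gaps (q : ℝ) (Y : Set ℝ) : Set (Set ℝ) :=
  {I | ∃ x ∈ Set.Ioc q (sSup Y) \ Y, I = connectedComponentIn (Set.Ioc q (sSup Y) \ Y) x}

theorem notMem_of_mem_gap {q : ℝ} {Y : Set ℝ} (I : gaps q Y) {x : ℝ} (hx : x ∈ I.1) : x ∉ Y := by
  obtain ⟨y, -, e⟩ := I.2
  rw [e] at hx
  exact (connectedComponentIn_subset _ _ hx).2

/-- The function `χ_{(a,b)}` in `C(Y)`, for `a, b` not in `Y`. -/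
def chi (Y : Set ℝ) (a b : ℝ) (ha : a ∉ Y) (hb : b ∉ Y) : C(Y, ℂ) where
  toFun t := (Set.Ioo a b).indicator (fun _ => (1 : ℂ)) t
  continuous_toFun := by
    have h : IsClopen ((↑) ⁻¹' Set.Ioo a b : Set Y) := by
      refine ⟨?_, isOpen_Ioo.preimage continuous_subtype_val⟩
      have e : ((↑) ⁻¹' Set.Ioo a b : Set Y) = (↑) ⁻¹' Set.Icc a b := by
        ext ⟨t, ht⟩
        have h1 : a ≠ t := fun h => ha (h ▸ ht)
        have h2 : t ≠ b := fun h => hb (h ▸ ht)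
        exact ⟨fun h => ⟨h.1.le, h.2.le⟩, fun h => ⟨lt_of_le_of_ne h.1 h1, lt_of_le_of_ne h.2 h2⟩⟩
      rw [e]
      exact isClosed_Icc.preimage continuous_subtype_val
    have hc : Continuous (((↑) ⁻¹' Set.Ioo a b : Set Y).indicator fun _ => (1 : ℂ)) :=
      continuous_const.indicator (by simp [h.frontier_eq])
    exact hc

theorem isStarProjection_chi (Y : Set ℝ) (a b : ℝ) (ha : a ∉ Y) (hb : b ∉ Y) :
    IsStarProjection (chi Y a b ha hb) := by
  refine ⟨?_, ?_⟩
  · ext t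
    simp [chi, Set.indicator]
  · ext t
    simp [chi, Set.indicator]

/-- The class `[χ_{(a,b)}]` in `K₀(C(Y))`. -/
def chiClass (Y : Set ℝ) (a b : ℝ) (ha : a ∉ Y) (hb : b ∉ Y) : K0 C(Y, ℂ) :=
  K0.mk (ProjMat.ofElem (chi Y a b ha hb) (isStarProjection_chi Y a b ha hb))

end Planar

end KTheory

end

/-! ### Continuous lifts over compact subsets of the line -/

open Matrix

/-! Since `Y` lies on a line, lifting problems over it have no obstruction: cut `Y` into short slabs
on which local sections exist and extend a lift from left to right, starting each slab at the value
already reached (`exists_continuous_lift`). Both K-groups come down to this.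

For `K₁`, a unitary matrix over `C(Y)` is a map from `Y` to a unitary group. Lifting it along the
endpoint map of paths issuing from `1` gives a homotopy to `1`.

For `K₀`, partial isometries map onto pairs of equivalent projections, with local sections obtained
by rotating nearby projections into each other. Hence projections over `C(Y)` with equal trace, that
is, equal pointwise rank, are equivalent, and the trace embeds `K₀(C(Y))` in the integer-valued
functions of `C(Y)`. It remains to see that the functions `χ_{(c_j,1)}` form a basis of `C(Y, ℤ)`.
They span because an integer-valued continuous function is a finite combination of steps that jump
off `Y`; they are independent because the first point of `Y` after the leftmost `c_j` sees only that
step.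

With finitely many components, `C(Y, ℤ)` consists of the functions on the set of components. With
infinitely many, the gaps are infinite and countable in number, and they index a basis. -/

/-- Continuous maps from a compact subset of the line lift along a surjection which has, near each
point of the base, continuous local sections of uniform size through all points of the fibres. -/
theorem exists_continuous_lift {E B : Type*} [TopologicalSpace E] [TopologicalSpace B]
    (π : E → B) (hπ : Function.Surjective π)
    (hloc : ∀ b₀, ∃ W ∈ nhds b₀, ∀ e, π e ∈ W →
      ∃ σ : B → E, ContinuousOn σ W ∧ (∀ b ∈ W, π (σ b) = b) ∧ σ (π e) = e)
    {Y : Set ℝ} (hY : IsCompact Y) (f : Y → B) (hf : Continuous f) :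
    ∃ g : Y → E, Continuous g ∧ ∀ y, π (g y) = f y := by
  rcases isEmpty_or_nonempty Y with hE | ⟨⟨yy⟩⟩
  · exact ⟨fun y => isEmptyElim y, continuous_of_const fun y => isEmptyElim y,
      fun y => isEmptyElim y⟩
  choose W hW hσ using hloc
  have : CompactSpace Y := isCompact_iff_compactSpace.mp hY
  obtain ⟨δ, hδ, hball⟩ := lebesgue_number_lemma_of_metric (s := (Set.univ : Set Y))
    (c := fun y : Y => interior (f ⁻¹' W (f y))) isCompact_univ (fun _ => isOpen_interior)
    (fun y _ => Set.mem_iUnion.2 ⟨y, mem_interior_iff_mem_nhds.2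
      (hf.continuousAt.preimage_mem_nhds (hW _))⟩)
  obtain ⟨a, ha⟩ := hY.bddBelow
  obtain ⟨b, hb⟩ := hY.bddAbove
  -- Slabs of width `δ / 2` keep any two points of a slab within the Lebesgue number. Starting at `a
  -- - 1` makes stage `0` vacuous.
  have key : ∀ k : ℕ, ∃ g : Y → E, ContinuousOn g {y : Y | (y : ℝ) ≤ a - 1 + k * (δ / 2)} ∧
      ∀ y : Y, (y : ℝ) ≤ a - 1 + k * (δ / 2) → π (g y) = f y := by
    intro k
    induction k with
    | zero =>
      have h0 : ∀ y : Y, ¬ (y : ℝ) ≤ a - 1 + (0 : ℕ) * (δ / 2) := by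
        intro y hy
        have := ha y.2
        simp at hy
        linarith
      exact ⟨fun _ => (hπ (f yy)).choose, continuousOn_const, fun y hy => (h0 y hy).elim⟩
    | succ k ih =>
      obtain ⟨g, hg, hgf⟩ := ih
      set x := a - 1 + k * (δ / 2) with hx
      have hx' : a - 1 + ((k + 1 : ℕ) : ℝ) * (δ / 2) = x + δ / 2 := by
        rw [hx]; push_cast; ring
      rw [hx']
      by_cases hne : ∃ y : Y, x ≤ y ∧ (y : ℝ) ≤ x + δ / 2
      -- If the cut `x` lies in `Y`, the section must pass through the lift already built there. If
      -- not, nothing has to match, as the two closed pieces are disjoint.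
      · obtain ⟨y₀, hy₀, hy₀'⟩ : ∃ y : Y, (x ≤ y ∧ (y : ℝ) ≤ x + δ / 2) ∧ (x ∈ Y → (y : ℝ) = x) := by
          by_cases hxY : x ∈ Y
          · exact ⟨⟨x, hxY⟩, ⟨le_rfl, show x ≤ x + δ / 2 by linarith⟩, fun _ => rfl⟩
          · obtain ⟨y, hy⟩ := hne
            exact ⟨y, hy, fun h => (hxY h).elim⟩
        obtain ⟨e, he, heg⟩ : ∃ e, π e = f y₀ ∧ (x ∈ Y → g y₀ = e) := by
          by_cases hxY : x ∈ Y
          · exact ⟨g y₀, hgf _ (hy₀' hxY).le, fun _ => rfl⟩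
          · obtain ⟨e, he⟩ := hπ (f y₀)
            exact ⟨e, he, fun h => (hxY h).elim⟩
        obtain ⟨i, hi⟩ := hball y₀ trivial
        have hmem : ∀ y : Y, x ≤ y → (y : ℝ) ≤ x + δ / 2 → f y ∈ W (f i) := by
          intro y h1 h2
          apply interior_subset (hi _)
          rw [Metric.mem_ball, Subtype.dist_eq, Real.dist_eq, abs_lt]
          constructor <;> linarith [hy₀.1, hy₀.2]
        obtain ⟨σ, hσc, hσs, hσe⟩ := hσ (f i) e (he ▸ hmem y₀ hy₀.1 hy₀.2)
        have hcomp : ∀ y : Y, (y : ℝ) = x → g y = σ (f y) := by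
          intro y hy
          have hxY : x ∈ Y := hy ▸ y.2
          have : y = y₀ := Subtype.ext (hy.trans (hy₀' hxY).symm)
          rw [this, ← he, hσe, heg hxY]
        have hU : {y : Y | (y : ℝ) ≤ x + δ / 2} =
            {y : Y | (y : ℝ) ≤ x} ∪ {y : Y | x ≤ (y : ℝ) ∧ (y : ℝ) ≤ x + δ / 2} := by
          ext y
          simp only [Set.mem_ofPred_eq, Set.mem_union]
          constructor
          · intro h
            rcases le_total (y : ℝ) x with h' | h'
            · exact Or.inl h'
            · exact Or.inr ⟨h', h⟩
          · rintro (h | h)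
            · linarith
            · exact h.2
        classical
        refine ⟨fun y => if (y : ℝ) ≤ x then g y else σ (f y), ?_, ?_⟩
        · rw [hU]
          refine ContinuousOn.union_of_isClosed ?_ ?_
            (isClosed_le continuous_subtype_val continuous_const)
            ((isClosed_le continuous_const continuous_subtype_val).inter
              (isClosed_le continuous_subtype_val continuous_const))
          · exact hg.congr fun y (hy : (y : ℝ) ≤ x) => if_pos hy
          · refine (hσc.comp hf.continuousOn fun y hy => hmem y hy.1 hy.2).congr ?_
            intro y hy
            by_cases h : (y : ℝ) ≤ x
            · simp only [if_pos h]
              exact hcomp y (le_antisymm h hy.1)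
            · simp only [if_neg h]
              rfl
        · intro y hy
          by_cases h : (y : ℝ) ≤ x
          · simp only [if_pos h]
            exact hgf y h
          · simp only [if_neg h]
            exact hσs _ (hmem y (not_le.1 h).le hy)
      · have h1 : ∀ y : Y, (y : ℝ) ≤ x + δ / 2 → (y : ℝ) ≤ x := fun y hy =>
          le_of_not_ge fun h => hne ⟨y, h, hy⟩
        exact ⟨g, hg.mono h1, fun y hy => hgf y (h1 y hy)⟩
  obtain ⟨k, hk⟩ := exists_nat_gt ((b - a + 1) / (δ / 2))
  rw [div_lt_iff₀ (by positivity)] at hk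
  have hall : ∀ y : Y, (y : ℝ) ≤ a - 1 + k * (δ / 2) := fun y => by
    linarith [hb y.2]
  obtain ⟨g, hg, hgf⟩ := key k
  refine ⟨g, ?_, fun y => hgf y (hall y)⟩
  rw [← continuousOn_univ]
  exact hg.mono fun y _ => hall y

/-! ### Matrices over `C(X)` as matrix-valued functions -/

section Evaluation

variable {X : Type*} [TopologicalSpace X] {l m n : Type*}

/-- The value at `x` of a matrix over `C(X)`. -/
noncomputable def Matrix.evalAt (x : X) (M : Matrix m n C(X, ℂ)) : Matrix m n ℂ := M.map fun f => f x

theorem Matrix.evalAt_mul [Fintype m] (x : X) (M : Matrix l m C(X, ℂ)) (N : Matrix m n C(X, ℂ)) :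
    (M * N).evalAt x = M.evalAt x * N.evalAt x :=
  Matrix.map_mul (f := ContinuousMap.evalStarAlgHom ℂ ℂ x)

theorem Matrix.evalAt_conjTranspose (x : X) (M : Matrix m n C(X, ℂ)) :
    Mᴴ.evalAt x = (M.evalAt x)ᴴ := rfl

theorem Matrix.evalAt_one [DecidableEq m] (x : X) :
    (1 : Matrix m m C(X, ℂ)).evalAt x = 1 :=
  Matrix.map_one _ rfl rfl

theorem Matrix.ext_evalAt {M N : Matrix m n C(X, ℂ)} (h : ∀ x, M.evalAt x = N.evalAt x) :
    M = N := by
  ext i j x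
  exact congrFun (congrFun (h x) i) j

theorem Matrix.continuous_evalAt (M : Matrix m n C(X, ℂ)) : Continuous fun x => M.evalAt x :=
  continuous_matrix fun i j => (M i j).continuous

/-- A continuous matrix-valued function, as a matrix over `C(X)`. -/
noncomputable def Matrix.ofContinuous (g : X → Matrix m n ℂ) (hg : Continuous g) : Matrix m n C(X, ℂ) :=
  Matrix.of fun i j => ⟨fun x => g x i j, hg.matrix_elem i j⟩

theorem Matrix.evalAt_ofContinuous (g : X → Matrix m n ℂ) (hg : Continuous g) (x : X) :
    (Matrix.ofContinuous g hg).evalAt x = g x := rfl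

theorem Matrix.mem_unitary_iff_evalAt [Fintype m] [DecidableEq m] {M : Matrix m m C(X, ℂ)} :
    M ∈ unitary (Matrix m m C(X, ℂ)) ↔ ∀ x, M.evalAt x ∈ unitary (Matrix m m ℂ) := by
  simp only [Unitary.mem_iff, star_eq_conjTranspose]
  constructor
  · intro h x
    rw [← evalAt_conjTranspose, ← evalAt_mul, ← evalAt_mul, h.1, h.2, evalAt_one]
    exact ⟨rfl, rfl⟩
  · intro h
    constructor <;> refine ext_evalAt fun x => ?_
    · rw [evalAt_mul, evalAt_conjTranspose, (h x).1, evalAt_one]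
    · rw [evalAt_mul, evalAt_conjTranspose, (h x).2, evalAt_one]

end Evaluation

/-! ### Local sections for paths of unitaries -/

section PathLifting

variable {A : Type*} [CStarAlgebra A]

open Metric selfAdjoint

/-- Paths of unitaries starting at `1`. -/
abbrev UnitaryPath (A : Type*) [CStarAlgebra A] : Type _ :=
  {γ : C(unitInterval, unitary A) // γ 0 = 1}

/-- Near a unitary, evaluation at the endpoint of paths of unitaries has continuous sections. -/
theorem exists_section_endpoint (b₀ : unitary A) :
    ∃ W ∈ nhds b₀, ∀ γ : UnitaryPath A, γ.1 1 ∈ W →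
      ∃ σ : unitary A → UnitaryPath A, ContinuousOn σ W ∧ (∀ b ∈ W, (σ b).1 1 = b) ∧
        σ (γ.1 1) = γ := by
  classical
  -- Radius `1` puts any two points of the ball at distance less than `2`, where the argument of
  -- their quotient is continuous.
  refine ⟨ball b₀ 1, ball_mem_nhds _ one_pos, fun γ hγ => ?_⟩
  set b := γ.1 1 with hb
  have hmem : ∀ b' ∈ ball b₀ 1, b⁻¹ * b' ∈ ball (1 : unitary A) 2 := by
    intro b' hb'
    have h : dist (b⁻¹ * b') 1 = dist b' b := by
      have h1 : ((b⁻¹ * b' : unitary A) : A) - 1 = (b⁻¹ : unitary A) * ((b' : A) - b) := by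
        rw [mul_sub, ← Submonoid.coe_mul, ← Submonoid.coe_mul, inv_mul_cancel,
          OneMemClass.coe_one]
      rw [Subtype.dist_eq, Subtype.dist_eq, dist_eq_norm, dist_eq_norm, OneMemClass.coe_one, h1,
        CStarRing.norm_coe_unitary_mul]
    rw [mem_ball, h]
    have := dist_triangle_right b' b b₀
    rw [mem_ball] at hγ hb'
    linarith
  -- Twisting `γ` by the exponential path from `1` to `b⁻¹ * b'` moves its endpoint from `b` to
  -- `b'`, and changes nothing when `b' = b`.
  let H : unitary A → unitInterval → unitary A := fun b' s =>
    γ.1 s * expUnitary ((s : ℝ) • Unitary.argSelfAdjoint (b⁻¹ * b'))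
  have hH : ContinuousOn (Function.uncurry H) (ball b₀ 1 ×ˢ Set.univ) := by
    have h1 : ContinuousOn (fun z : unitary A × unitInterval =>
        Unitary.argSelfAdjoint (b⁻¹ * z.1)) (ball b₀ 1 ×ˢ Set.univ) :=
      Unitary.continuousOn_argSelfAdjoint.comp (by fun_prop) fun z hz => hmem _ hz.1
    have h2 : ContinuousOn (fun z : unitary A × unitInterval => (z.2 : ℝ))
      (ball b₀ 1 ×ˢ Set.univ) := by fun_prop
    exact (γ.1.continuous.comp continuous_snd).continuousOn.mul
      (continuous_expUnitary.comp_continuousOn (h2.smul h1))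
  have hHc : ∀ b' : ball b₀ 1, Continuous (H b') := fun b' => by
    rw [← continuousOn_univ]
    exact hH.comp (f := fun s => (b'.1, s)) (by fun_prop) fun s _ => ⟨b'.2, trivial⟩
  have hH0 : ∀ b', H b' 0 = 1 := fun b' => by simp [H, γ.2]
  let σ : ball b₀ 1 → UnitaryPath A := fun b' => ⟨⟨H b', hHc b'⟩, hH0 _⟩
  have hσ : Continuous σ := by
    refine Continuous.subtype_mk (ContinuousMap.continuous_of_continuous_uncurry _ ?_) _
    exact hH.comp_continuous (f := fun z : ball b₀ 1 × unitInterval => (z.1.1, z.2))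
      (by fun_prop) fun z => ⟨z.1.2, trivial⟩
  refine ⟨fun b' => if h : b' ∈ ball b₀ 1 then σ ⟨b', h⟩ else γ, ?_, ?_, ?_⟩
  · rw [continuousOn_iff_continuous_domRestrict]
    refine hσ.congr fun b' => ?_
    simp [Set.domRestrict, b'.2]
  · intro b' hb'
    simp only [dif_pos hb']
    change γ.1 1 * expUnitary (((1 : unitInterval) : ℝ) • Unitary.argSelfAdjoint (b⁻¹ * b')) = b'
    have h := hmem b' hb'
    rw [mem_ball, Subtype.dist_eq, dist_eq_norm] at h
    rw [Set.Icc.coe_one, one_smul, expUnitary_argSelfAdjoint h, ← hb, mul_inv_cancel_left]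
  · simp only [dif_pos hγ]
    refine Subtype.ext (ContinuousMap.ext fun s => ?_)
    change γ.1 s * expUnitary ((s : ℝ) • Unitary.argSelfAdjoint (b⁻¹ * b)) = γ.1 s
    have h : Unitary.argSelfAdjoint (1 : unitary A) = 0 := by
      have := argSelfAdjoint_expUnitary (A := A) (x := 0) (by simpa using Real.pi_pos)
      simpa using this
    rw [inv_mul_cancel, h, smul_zero, expUnitary_zero, mul_one]

/-- A unitary with finite spectrum is an exponential. -/
theorem exists_expUnitary_of_finite_spectrum (u : unitary A) (hu : (spectrum ℂ (u : A)).Finite) :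
    ∃ x : selfAdjoint A, expUnitary x = u := by
  refine ⟨Unitary.argSelfAdjoint u, ?_⟩
  ext
  -- Every function on a finite set is continuous, so the jump of `arg` at `-1` does no harm.
  have : ContinuousOn Complex.arg (spectrum ℂ (u : A)) := hu.continuousOn _
  rw [expUnitary_coe, Unitary.argSelfAdjoint_coe, ← CFC.exp_eq_normedSpace_exp (𝕜 := ℂ),
    ← cfc_comp_smul .., ← cfc_comp' ..]
  conv_rhs => rw [← cfc_id' ℂ (u : A)]
  refine cfc_congr fun y hy ↦ ?_
  have hy₁ : ‖y‖ = 1 := spectrum.norm_eq_one_of_unitary u.2 hy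
  have hy0 : y ≠ 0 := by
    rintro rfl
    simp at hy₁
  have : Complex.I * y.arg = Complex.log y :=
    Complex.ext (by simp [Complex.log_re, hy₁]) (by simp [Complex.log_im])
  simpa [← Complex.exp_eq_exp_ℂ, this] using Complex.exp_log hy0

end PathLifting

/-! ### Vanishing of `K₁` -/

section Matrices

open scoped Matrix.Norms.L2Operator
open selfAdjoint

theorem endpoint_unitaryPath_surjective (n : ℕ) :
    Function.Surjective fun γ : UnitaryPath (Matrix (Fin n) (Fin n) ℂ) => γ.1 1 := by
  intro u
  obtain ⟨x, rfl⟩ := exists_expUnitary_of_finite_spectrum u (Matrix.finite_spectrum _)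
  exact ⟨⟨⟨fun s => expUnitary ((s : ℝ) • x), by fun_prop⟩, by simp⟩, by simp⟩

variable {Y : Set ℝ}

/-- Unitary matrices over `C(Y)`, with `Y` a compact subset of the line, are homotopic to `1`. -/
theorem joined_one_unitary_matrix (hY : IsCompact Y) (n : ℕ)
    (u : unitary (Matrix (Fin n) (Fin n) C(Y, ℂ))) : Joined 1 u := by
  let ev : Y → unitary (Matrix (Fin n) (Fin n) ℂ) := fun y =>
    ⟨u.1.evalAt y, mem_unitary_iff_evalAt.1 u.2 y⟩
  have hev : Continuous ev := u.1.continuous_evalAt.subtype_mk _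
  obtain ⟨g, hg, hgu⟩ := exists_continuous_lift
    (fun γ : UnitaryPath (Matrix (Fin n) (Fin n) ℂ) => γ.1 1)
    (endpoint_unitaryPath_surjective n) exists_section_endpoint hY ev hev
  have hG : Continuous fun z : unitInterval × Y => (g z.2).1 z.1 := by
    have h1 : Continuous fun z : unitInterval × Y => ((g z.2).1, z.1) := by fun_prop
    exact ContinuousEval.continuous_eval.comp h1
  let F (s : unitInterval) : Matrix (Fin n) (Fin n) C(Y, ℂ) :=
    Matrix.ofContinuous (fun y => ((g y).1 s : Matrix (Fin n) (Fin n) ℂ))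
      (continuous_subtype_val.comp (hG.comp (by fun_prop : Continuous fun y => (s, y))))
  have hF : Continuous F := continuous_matrix fun i j =>
    (ContinuousMap.curry ⟨fun z : unitInterval × Y =>
      ((g z.2).1 z.1 : Matrix (Fin n) (Fin n) ℂ) i j,
      (continuous_subtype_val.comp hG).matrix_elem i j⟩).continuous
  refine ⟨⟨⟨fun s => ⟨F s, mem_unitary_iff_evalAt.2 fun y => ((g y).1 s).2⟩,
    hF.subtype_mk _⟩, ?_, ?_⟩⟩
  · refine Subtype.ext (ext_evalAt fun y => ?_)
    have := congrArg Subtype.val (g y).2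
    exact this.trans (evalAt_one y).symm
  · refine Subtype.ext (ext_evalAt fun y => ?_)
    exact congrArg Subtype.val (hgu y)

end Matrices

namespace KTheory

theorem subsingleton_K1 {Y : Set ℝ} (hY : IsCompact Y) : Subsingleton (K1 C(Y, ℂ)) := by
  have h : AddSubgroup.closure {x | K1Rel C(Y, ℂ) x} = ⊤ := by
    refine eq_top_iff.2 fun x _ => ?_
    induction x using FreeAbelianGroup.induction_on with
    | zero => exact zero_mem _
    | of u =>
      obtain ⟨n, u⟩ := u
      have h1 := AddSubgroup.subset_closure
        (K1Rel.path n u 1 (joined_one_unitary_matrix hY n u).symm)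
      have h2 := AddSubgroup.subset_closure (K1Rel.one (A := C(Y, ℂ)) n)
      have h3 := add_mem h1 h2
      rwa [sub_add_cancel] at h3
    | neg u h => exact neg_mem (h trivial)
    | add x y hx hy => exact add_mem (hx trivial) (hy trivial)
  unfold K1
  rw [h]
  exact QuotientAddGroup.subsingleton_quotient_top

end KTheory

/-! ### Rotating nearby projections into each other -/

section Intertwiner

variable {A : Type*} [CStarAlgebra A]

/-- A unitary `u` with `u * p = p' * u`, for nearby projections `p` and `p'`: the unitary part in
the polar decomposition of `p' * p + (1 - p') * (1 - p)`. -/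
noncomputable def projIntertwiner (p' p : A) : A :=
  (p' * p + (1 - p') * (1 - p)) * cfc (fun x : ℝ => (√x)⁻¹)
    (star (p' * p + (1 - p') * (1 - p)) * (p' * p + (1 - p') * (1 - p)))

theorem norm_mul_add_one_sub_mul_one_sub_le {p' p : A} (hp' : IsStarProjection p')
    (hp : IsStarProjection p) :
    ‖p' * p + (1 - p') * (1 - p) - 1‖ ≤ 2 * ‖p' - p‖ := by
  have h1 : p' * p + (1 - p') * (1 - p) - 1 = p' * (p - p') + (p' - p) * p := by
    have h2 := hp'.isIdempotentElem.eq
    have h3 := hp.isIdempotentElem.eq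
    simp only [mul_sub, sub_mul, h2, h3, mul_one, one_mul]
    abel
  rw [h1]
  have h2 := norm_mul_le p' (p - p')
  have h3 := norm_mul_le (p' - p) p
  have h4 := hp'.norm_le
  have h5 := hp.norm_le
  rw [norm_sub_rev p p'] at h2
  have h6 := norm_add_le (p' * (p - p')) ((p' - p) * p)
  nlinarith [norm_nonneg (p' - p)]

/-- One interval away from `0` contains all these spectra, so the inverse square root is continuous
on it and its functional calculus varies continuously with the element. -/
theorem spectrum_star_mul_self_subset {z : A} (hz : ‖z - 1‖ ≤ 1 / 5) :
    spectrum ℝ (star z * z) ⊆ Set.Icc (1 / 2) (3 / 2) := by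
  rcases subsingleton_or_nontrivial A with _ | _
  · simp [spectrum.of_subsingleton]
  have h1 : star z * z - 1 = star (z - 1) * z + (z - 1) := by
    simp [sub_mul]
  have h2 : ‖z‖ ≤ 6 / 5 := by
    have := norm_add_le (z - 1) 1
    rw [sub_add_cancel, norm_one] at this
    linarith
  have h3 : ‖star z * z - 1‖ ≤ 1 / 2 := by
    rw [h1]
    refine (norm_add_le _ _).trans ?_
    have := norm_mul_le (star (z - 1)) z
    rw [norm_star] at this
    nlinarith [norm_nonneg z, norm_nonneg (z - 1)]
  intro x hx
  have h4 : x - 1 ∈ spectrum ℝ (star z * z - 1) := by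
    have := (spectrum.sub_singleton_eq (star z * z) (1 : ℝ)).symm ▸
      Set.sub_mem_sub hx (Set.mem_singleton (1 : ℝ))
    simpa using this
  have h5 := (spectrum.norm_le_norm_of_mem h4).trans h3
  rw [Real.norm_eq_abs, abs_le] at h5
  constructor <;> linarith [h5.1, h5.2]

theorem continuousOn_inv_sqrt : ContinuousOn (fun x : ℝ => (√x)⁻¹) (Set.Icc (1 / 2) (3 / 2)) :=
  Real.continuous_sqrt.continuousOn.inv₀ fun x hx =>
    (Real.sqrt_pos.2 (by linarith [hx.1])).ne'

/-- Distance `1 / 10` gives `‖z - 1‖ ≤ 1 / 5` for `z = p' * p + (1 - p') * (1 - p)`, which makes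
`star z * z` invertible; then the computation is `x⁻¹ * x = 1` on its spectrum. -/
theorem star_mul_projIntertwiner {p' p : A} (hp' : IsStarProjection p')
    (hp : IsStarProjection p) (h : ‖p' - p‖ ≤ 1 / 10) :
    star (projIntertwiner p' p) * projIntertwiner p' p = 1 := by
  have hz := (norm_mul_add_one_sub_mul_one_sub_le hp' hp).trans
    (by linarith : _ ≤ (1 : ℝ) / 5)
  unfold projIntertwiner
  set z := p' * p + (1 - p') * (1 - p)
  have hs := spectrum_star_mul_self_subset hz
  have hc := continuousOn_inv_sqrt.mono hs
  have ha : IsSelfAdjoint (star z * z) := IsSelfAdjoint.star_mul_self z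
  have h1 : star (cfc (fun x : ℝ => (√x)⁻¹) (star z * z)) =
    cfc (fun x : ℝ => (√x)⁻¹) (star z * z) := (cfc_predicate _ _ : IsSelfAdjoint _).star_eq
  rw [star_mul, h1, mul_assoc, ← mul_assoc (star z) z]
  conv_lhs => enter [2, 1]; rw [← cfc_id' ℝ (star z * z)]
  rw [← cfc_mul _ _ _ (by fun_prop) hc, ← cfc_mul _ _ _ hc (by fun_prop), ← cfc_one ℝ (star z * z)]
  refine cfc_congr fun x hx => ?_
  have hx0 : 0 < x := by linarith [(hs hx).1]
  have := Real.sq_sqrt hx0.le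
  have h2 := (Real.sqrt_pos.2 hx0).ne'
  simp only [Pi.one_apply]
  field_simp
  exact this.symm

/-- The relation `z * p = p' * z` and its adjoint make `star z * z`, hence every function of it,
commute with `p`. No closeness is needed. -/
theorem projIntertwiner_mul {p' p : A} (hp' : IsStarProjection p') (hp : IsStarProjection p) :
    projIntertwiner p' p * p = p' * projIntertwiner p' p := by
  unfold projIntertwiner
  set z := p' * p + (1 - p') * (1 - p) with hzdef
  have h2 := hp'.isIdempotentElem.eq
  have h3 := hp.isIdempotentElem.eq
  have hz : z * p = p' * z := by
    simp only [hzdef, mul_sub, sub_mul, mul_add, add_mul, mul_one, one_mul, mul_assoc, h3]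
    simp only [← mul_assoc, h2]
    abel
  have hz' : star z * p' = p * star z := by
    have := congrArg star hz
    rw [star_mul, star_mul, hp.isSelfAdjoint.star_eq, hp'.isSelfAdjoint.star_eq] at this
    exact this.symm
  have hcomm : Commute (star z * z) p := by
    rw [Commute, SemiconjBy, mul_assoc, hz, ← mul_assoc, hz', mul_assoc]
  rw [mul_assoc, (hcomm.cfc_real _).eq, ← mul_assoc, hz, mul_assoc]

theorem projIntertwiner_self {p : A} (hp : IsStarProjection p) : projIntertwiner p p = 1 := by
  have h3 := hp.isIdempotentElem.eq
  have : p * p + (1 - p) * (1 - p) = 1 := by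
    simp [mul_sub, sub_mul, h3]
  rw [projIntertwiner, this, star_one, mul_one, one_mul]
  simp [cfc_apply_one]

theorem continuousOn_projIntertwiner {p : A} (hp : IsStarProjection p) :
    ContinuousOn (fun p' => projIntertwiner p' p)
      {p' | IsStarProjection p' ∧ ‖p' - p‖ ≤ 1 / 10} := by
  unfold projIntertwiner
  refine ContinuousOn.mul (by fun_prop) ?_
  refine ContinuousOn.cfc' isCompact_Icc _ (by fun_prop) (fun p' hp' => ?_)
    (fun p' _ => IsSelfAdjoint.star_mul_self _) continuousOn_inv_sqrt
  exact spectrum_star_mul_self_subset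
    ((norm_mul_add_one_sub_mul_one_sub_le hp'.1 hp).trans (by linarith [hp'.2]))

end Intertwiner

/-! ### Equivalence of projections from equality of traces -/

namespace KTheory

/-- The eigenvalues are `0` or `1`; orthonormal eigenvectors for `1`, taken as columns, form the
required isometry. -/
theorem exists_mvN_one {m : Type*} [Fintype m] {p : Matrix m m ℂ} (hp : IsStarProjection p) :
    ∃ k : ℕ, MvN p (1 : Matrix (Fin k) (Fin k) ℂ) := by
  classical
  have hA : p.IsHermitian := hp.isSelfAdjoint
  set U := hA.eigenvectorUnitary
  have hU2 : (U : Matrix m m ℂ)ᴴ * (U : Matrix m m ℂ) = 1 := Unitary.star_mul_self_of_mem U.2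
  have hsp : p = U * diagonal (fun i => (hA.eigenvalues i : ℂ)) * (U : Matrix m m ℂ)ᴴ :=
    hA.spectral_theorem
  have h01 : ∀ i, hA.eigenvalues i = 0 ∨ hA.eigenvalues i = 1 := fun i => by
    have := (isIdempotentElem_iff_spectrum_subset ℝ p hp.isSelfAdjoint).1 hp.isIdempotentElem
      (hA.eigenvalues_mem_spectrum_real i)
    simpa using this
  let e := (Fintype.equivFin {i // hA.eigenvalues i = 1}).symm
  refine ⟨_, (U : Matrix m m ℂ).submatrix id (fun k => (e k : m)), ?_, ?_⟩
  · conv_rhs => rw [hsp]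
    ext i j
    rw [Matrix.mul_apply, Matrix.mul_apply]
    simp only [Matrix.mul_diagonal, submatrix_apply, conjTranspose_apply, id]
    rw [e.sum_comp (fun k : {i // hA.eigenvalues i = 1} => (U : Matrix m m ℂ) i k *
      star ((U : Matrix m m ℂ) j k))]
    rw [← Finset.sum_subtype (Finset.univ.filter fun k => hA.eigenvalues k = 1) (by simp)
      (fun k => (U : Matrix m m ℂ) i k * star ((U : Matrix m m ℂ) j k)), Finset.sum_filter]
    refine Finset.sum_congr rfl fun k _ => ?_
    rcases h01 k with h | h <;> simp [h]
  · rw [conjTranspose_submatrix, ← submatrix_mul _ _ _ id _ Function.bijective_id, hU2]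
    exact submatrix_one _ (Subtype.val_injective.comp e.injective)

theorem MvN.trace_eq {R m n : Type*} [CommRing R] [StarRing R] [Fintype m] [Fintype n]
    {p : Matrix m m R} {q : Matrix n n R} (h : MvN p q) : p.trace = q.trace := by
  obtain ⟨v, rfl, rfl⟩ := h
  exact trace_mul_comm _ _

theorem mvN_of_trace_eq {m n : Type*} [Fintype m] [Fintype n] {p : Matrix m m ℂ}
    {q : Matrix n n ℂ} (hp : IsStarProjection p) (hq : IsStarProjection q)
    (h : p.trace = q.trace) : MvN p q := by
  obtain ⟨k, hk⟩ := exists_mvN_one hp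
  obtain ⟨l, hl⟩ := exists_mvN_one hq
  have h1 := hk.trace_eq
  have h2 := hl.trace_eq
  rw [trace_one, Fintype.card_fin] at h1 h2
  obtain rfl : k = l := by exact_mod_cast (h1.symm.trans h).trans h2
  exact hk.trans hp.isIdempotentElem hq.isIdempotentElem hl.symm

open scoped Matrix.Norms.L2Operator

/-- Pairs of equivalent projections. -/
abbrev MvNPairs (m n : Type*) [Fintype m] [Fintype n] : Type _ :=
  {b : Matrix m m ℂ × Matrix n n ℂ // IsStarProjection b.1 ∧ IsStarProjection b.2 ∧ MvN b.1 b.2}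

/-- Partial isometries. -/
abbrev PartialIsometries (m n : Type*) [Fintype m] [Fintype n] : Type _ :=
  {v : Matrix m n ℂ // IsStarProjection (v * vᴴ) ∧ IsStarProjection (vᴴ * v)}

/-- The range and source projection of a partial isometry. -/
def PartialIsometries.pair {m n : Type*} [Fintype m] [Fintype n] (v : PartialIsometries m n) :
    MvNPairs m n := ⟨(v.1 * v.1ᴴ, v.1ᴴ * v.1), v.2.1, v.2.2, v.1, rfl, rfl⟩

theorem PartialIsometries.pair_surjective {m n : Type*} [Fintype m] [Fintype n] :
    Function.Surjective (pair (m := m) (n := n)) := by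
  rintro ⟨⟨p, q⟩, hp, hq, v, h1, h2⟩
  dsimp only at h1 h2 hp hq
  subst h1 h2
  exact ⟨⟨v, hp, hq⟩, rfl⟩

/-- If `S` and `T` rotate the range and source projections of `v` to nearby ones, `S * v * Tᴴ` has
the new projections. As `S = T = 1` at the pair of `v`, this section passes through `v`. Radius `1 /
20` about `b₀` keeps pairs within `1 / 10` of each other. -/
theorem PartialIsometries.exists_section {m n : Type*} [Fintype m] [Fintype n] [DecidableEq m]
    [DecidableEq n] (b₀ : MvNPairs m n) :
    ∃ W ∈ nhds b₀, ∀ v : PartialIsometries m n, v.pair ∈ W →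
      ∃ σ : MvNPairs m n → PartialIsometries m n, ContinuousOn σ W ∧ (∀ b ∈ W, (σ b).pair = b) ∧
        σ v.pair = v := by
  classical
  let W : Set (MvNPairs m n) := {b | ‖b.1.1 - b₀.1.1‖ < 1 / 20 ∧ ‖b.1.2 - b₀.1.2‖ < 1 / 20}
  have hW : W ∈ nhds b₀ := by
    refine IsOpen.mem_nhds (IsOpen.inter ?_ ?_) (by simp [W])
    · exact isOpen_lt (f := fun b : MvNPairs m n => ‖b.1.1 - b₀.1.1‖) (by fun_prop)
        continuous_const
    · exact isOpen_lt (f := fun b : MvNPairs m n => ‖b.1.2 - b₀.1.2‖) (by fun_prop)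
        continuous_const
  refine ⟨W, hW, fun v hv => ?_⟩
  have h1 : ∀ b ∈ W, ‖b.1.1 - v.pair.1.1‖ ≤ 1 / 10 := fun b hb => by
    have := norm_sub_le_norm_sub_add_norm_sub b.1.1 b₀.1.1 v.pair.1.1
    rw [norm_sub_rev b₀.1.1] at this
    linarith [hv.1, hb.1]
  have h2 : ∀ b ∈ W, ‖b.1.2 - v.pair.1.2‖ ≤ 1 / 10 := fun b hb => by
    have := norm_sub_le_norm_sub_add_norm_sub b.1.2 b₀.1.2 v.pair.1.2
    rw [norm_sub_rev b₀.1.2] at this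
    linarith [hv.2, hb.2]
  let w : MvNPairs m n → Matrix m n ℂ := fun b =>
    projIntertwiner b.1.1 v.pair.1.1 * v.1 * (projIntertwiner b.1.2 v.pair.1.2)ᴴ
  have hw1 : ∀ b ∈ W, w b * (w b)ᴴ = b.1.1 ∧ (w b)ᴴ * w b = b.1.2 := by
    intro b hb
    have e1 := star_mul_projIntertwiner b.2.1 v.2.1 (h1 b hb)
    have e2 := star_mul_projIntertwiner b.2.2.1 v.2.2 (h2 b hb)
    -- For square complex matrices an isometry is unitary.
    have e1' := mul_eq_one_comm.1 e1
    have e2' := mul_eq_one_comm.1 e2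
    have e3 := projIntertwiner_mul b.2.1 v.2.1
    have e4 := projIntertwiner_mul b.2.2.1 v.2.2
    rw [star_eq_conjTranspose] at e1 e2 e1' e2'
    simp only [w, PartialIsometries.pair] at *
    set S := projIntertwiner b.1.1 (v.1 * v.1ᴴ)
    set T := projIntertwiner b.1.2 (v.1ᴴ * v.1)
    constructor
    · calc S * v.1 * Tᴴ * (S * v.1 * Tᴴ)ᴴ = S * v.1 * (Tᴴ * T) * v.1ᴴ * Sᴴ := by
            simp only [conjTranspose_mul, conjTranspose_conjTranspose, Matrix.mul_assoc]
        _ = S * (v.1 * v.1ᴴ) * Sᴴ := by rw [e2]; simp only [Matrix.mul_one, Matrix.mul_assoc]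
        _ = b.1.1 := by rw [e3, Matrix.mul_assoc, e1', Matrix.mul_one]
    · calc (S * v.1 * Tᴴ)ᴴ * (S * v.1 * Tᴴ) = T * v.1ᴴ * (Sᴴ * S) * v.1 * Tᴴ := by
            simp only [conjTranspose_mul, conjTranspose_conjTranspose, Matrix.mul_assoc]
        _ = T * (v.1ᴴ * v.1) * Tᴴ := by rw [e1]; simp only [Matrix.mul_one, Matrix.mul_assoc]
        _ = b.1.2 := by rw [e4, Matrix.mul_assoc, e2', Matrix.mul_one]
  have hw2 : ∀ b ∈ W, IsStarProjection (w b * (w b)ᴴ) ∧ IsStarProjection ((w b)ᴴ * w b) := by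
    intro b hb
    rw [(hw1 b hb).1, (hw1 b hb).2]
    exact ⟨b.2.1, b.2.2.1⟩
  have hwc : ContinuousOn w W := by
    have c1 : ContinuousOn (fun b : MvNPairs m n => projIntertwiner b.1.1 v.pair.1.1) W :=
      (continuousOn_projIntertwiner v.2.1).comp (f := fun b : MvNPairs m n => b.1.1)
        (by fun_prop) fun b hb => ⟨b.2.1, h1 b hb⟩
    have c2 : ContinuousOn (fun b : MvNPairs m n => projIntertwiner b.1.2 v.pair.1.2) W :=
      (continuousOn_projIntertwiner v.2.2).comp (f := fun b : MvNPairs m n => b.1.2)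
        (by fun_prop) fun b hb => ⟨b.2.2.1, h2 b hb⟩
    rw [continuousOn_iff_continuous_domRestrict] at c1 c2 ⊢
    exact (c1.matrix_mul continuous_const).matrix_mul c2.matrix_conjTranspose
  refine ⟨fun b => if h : b ∈ W then ⟨w b, hw2 b h⟩ else v, ?_, ?_, ?_⟩
  · rw [continuousOn_iff_continuous_domRestrict] at hwc ⊢
    refine (hwc.subtype_mk fun b => hw2 b.1 b.2).congr fun b => ?_
    simp [Set.domRestrict, b.2]
  · intro b hb
    simp only [dif_pos hb]
    exact Subtype.ext (Prod.ext (hw1 b hb).1 (hw1 b hb).2)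
  · simp only [dif_pos hv]
    refine Subtype.ext ?_
    simp only [w]
    rw [projIntertwiner_self v.pair.2.1, projIntertwiner_self v.pair.2.2.1]
    simp

theorem _root_.IsStarProjection.evalAt {X m : Type*} [TopologicalSpace X] [Fintype m]
    {r : Matrix m m C(X, ℂ)} (hr : IsStarProjection r) (x : X) :
    IsStarProjection (r.evalAt x) := by
  refine ⟨?_, ?_⟩
  · rw [IsIdempotentElem, ← evalAt_mul, hr.isIdempotentElem.eq]
  · have := hr.isSelfAdjoint.star_eq
    rw [star_eq_conjTranspose] at this
    rw [IsSelfAdjoint, star_eq_conjTranspose, ← evalAt_conjTranspose, this]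

/-- Over a compact subset of the line, projections with the same rank function are equivalent. -/
theorem mvN_of_trace_eq_of_isCompact {Y : Set ℝ} (hY : IsCompact Y) {m n : Type*} [Fintype m]
    [Fintype n] {p : Matrix m m C(Y, ℂ)} {q : Matrix n n C(Y, ℂ)} (hp : IsStarProjection p)
    (hq : IsStarProjection q) (h : p.trace = q.trace) : MvN p q := by
  classical
  have htr : ∀ y, (p.evalAt y).trace = (q.evalAt y).trace := by
    intro y
    have := DFunLike.congr_fun h y
    simpa [trace, evalAt] using this
  let f : Y → MvNPairs m n := fun y => ⟨(p.evalAt y, q.evalAt y), hp.evalAt y, hq.evalAt y,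
    mvN_of_trace_eq (hp.evalAt y) (hq.evalAt y) (htr y)⟩
  have hf : Continuous f := by
    refine Continuous.subtype_mk ?_ _
    exact p.continuous_evalAt.prodMk q.continuous_evalAt
  obtain ⟨g, hg, hgf⟩ := exists_continuous_lift _ PartialIsometries.pair_surjective
    PartialIsometries.exists_section hY f hf
  refine ⟨Matrix.ofContinuous (fun y => (g y).1) (continuous_subtype_val.comp hg), ?_, ?_⟩
  · refine ext_evalAt fun y => ?_
    rw [evalAt_mul, evalAt_conjTranspose, evalAt_ofContinuous]
    exact congrArg (fun b => b.1.1) (hgf y)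
  · refine ext_evalAt fun y => ?_
    rw [evalAt_mul, evalAt_conjTranspose, evalAt_ofContinuous]
    exact congrArg (fun b => b.1.2) (hgf y)

end KTheory

/-! ### The trace on `K₀` and integer-valued functions -/

namespace KTheory

section Trace

theorem grothendieckAddGroup_exists_eq_sub {M : Type*} [AddCommMonoid M]
    (x : Algebra.GrothendieckAddGroup M) :
    ∃ a b, x = Algebra.GrothendieckAddGroup.of a - Algebra.GrothendieckAddGroup.of b := by
  induction x using AddLocalization.ind with
  | H y =>
    refine ⟨y.1, y.2, ?_⟩
    change _ = AddLocalization.mk y.1 0 - AddLocalization.mk (y.2 : M) 0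
    rw [Algebra.GrothendieckAddGroup.mk_sub_mk]
    simp

theorem trace_dirSum {A : Type*} [Ring A] {m n : ℕ} (a : Matrix (Fin m) (Fin m) A) (b : Matrix (Fin n) (Fin n) A) :
    (dirSum a b).trace = a.trace + b.trace := by
  have h := finSumFinEquiv.symm.sum_comp fun i => fromBlocks a 0 0 b i i
  rw [Fintype.sum_sum_type] at h
  exact h

variable {A : Type*} [CommRing A] [StarRing A]

variable (A) in
/-- The trace on classes of projections. -/
def ProjClass.trace : ProjClass A →+ A where
  toFun := Quotient.lift (fun p => p.mat.trace) fun _ _ h => MvN.trace_eq h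
  map_zero' := by
    change (ProjMat.zero A).mat.trace = 0
    exact Matrix.trace_fin_zero _
  map_add' := by
    rintro ⟨p⟩ ⟨q⟩
    exact trace_dirSum p.mat q.mat

variable (A) in
/-- The trace on `K₀` of a commutative algebra. -/
noncomputable def K0.trace : K0 A →+ A := Algebra.GrothendieckAddGroup.lift (ProjClass.trace A)

theorem K0.trace_mk (p : ProjMat A) : K0.trace A (K0.mk p) = p.mat.trace :=
  DFunLike.congr_fun
    (Algebra.GrothendieckAddGroup.lift.symm_apply_apply (ProjClass.trace A)) (Quotient.mk _ p)

theorem K0.exists_eq_sub (x : K0 A) : ∃ p q : ProjMat A, x = K0.mk p - K0.mk q := by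
  obtain ⟨a, b, h⟩ := grothendieckAddGroup_exists_eq_sub x
  obtain ⟨p, rfl⟩ := Quotient.exists_rep a
  obtain ⟨q, rfl⟩ := Quotient.exists_rep b
  exact ⟨p, q, h⟩

end Trace

/-- Equal traces already give equivalent projections, so no stabilization is needed in the
Grothendieck group. -/
theorem K0.trace_injective {Y : Set ℝ} (hY : IsCompact Y) :
    Function.Injective (K0.trace C(Y, ℂ)) := by
  refine (injective_iff_map_eq_zero _).2 fun x hx => ?_
  obtain ⟨p, q, rfl⟩ := K0.exists_eq_sub x
  rw [map_sub, K0.trace_mk, K0.trace_mk, sub_eq_zero] at hx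
  rw [sub_eq_zero]
  exact congrArg Algebra.GrothendieckAddGroup.of
    (Quotient.sound (mvN_of_trace_eq_of_isCompact hY p.isProj q.isProj hx))

section IntegerValued

/-- Integer-valued continuous functions, as complex-valued ones. -/
noncomputable def intCastHom (X : Type*) [TopologicalSpace X] : C(X, ℤ) →+ C(X, ℂ) :=
  (Int.castAddHom ℂ).compLeftContinuous X continuous_of_discreteTopology

variable {X : Type*} [TopologicalSpace X]

theorem intCastHom_apply (f : C(X, ℤ)) (x : X) : intCastHom X f x = f x := rfl

theorem intCastHom_injective : Function.Injective (intCastHom X) := fun f g h => by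
  ext x
  have := DFunLike.congr_fun h x
  rw [intCastHom_apply, intCastHom_apply] at this
  exact_mod_cast this

theorem mem_range_intCastHom {f : C(X, ℂ)} (h : ∀ x, ∃ n : ℤ, f x = n) :
    f ∈ (intCastHom X).range := by
  choose n hn using h
  refine ⟨⟨n, ?_⟩, ?_⟩
  · rw [Int.isClosedEmbedding_coe_real.isInducing.continuous_iff]
    refine (Complex.continuous_re.comp f.continuous).congr fun x => ?_
    simp [hn]
  · ext x
    exact (hn x).symm

theorem trace_mem_range_intCastHom {m : Type*} [Fintype m] {p : Matrix m m C(X, ℂ)}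
    (hp : IsStarProjection p) : p.trace ∈ (intCastHom X).range := by
  refine mem_range_intCastHom fun x => ?_
  obtain ⟨k, hk⟩ := exists_mvN_one (hp.evalAt x)
  have := hk.trace_eq
  rw [trace_one, Fintype.card_fin] at this
  refine ⟨k, ?_⟩
  rw [Int.cast_natCast, ← this]
  simp [trace, evalAt]

theorem K0.trace_mem_range_intCastHom (x : K0 C(X, ℂ)) :
    K0.trace _ x ∈ (intCastHom X).range := by
  obtain ⟨p, q, rfl⟩ := K0.exists_eq_sub x
  rw [map_sub, K0.trace_mk, K0.trace_mk]
  exact sub_mem (KTheory.trace_mem_range_intCastHom p.isProj)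
    (KTheory.trace_mem_range_intCastHom q.isProj)

/-- If `X` has finitely many components, the continuous functions `X → ℤ` are the functions on the
set of components. -/
noncomputable def connectedComponentsEquiv (X : Type*) [TopologicalSpace X]
    [Finite (ConnectedComponents X)] : (ConnectedComponents X → ℤ) ≃+ C(X, ℤ) :=
  AddEquiv.ofBijective
    (AddMonoidHom.mk' (fun g => (⟨fun x => g (ConnectedComponents.mk x),
      continuous_of_discreteTopology.comp ConnectedComponents.continuous_coe⟩ : C(X, ℤ)))
      fun _ _ => rfl)
    ⟨fun g g' h => funext fun C => by
      obtain ⟨x, rfl⟩ := ConnectedComponents.surjective_coe C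
      exact DFunLike.congr_fun h x,
    fun f => ⟨f.continuous.connectedComponentsLift, ContinuousMap.ext fun _ => rfl⟩⟩

end IntegerValued

/-! ### Gaps of `Y` and its components -/

section Gaps

variable {q : ℝ} {Y : Set ℝ}

theorem isPreconnected_gap (I : gaps q Y) : IsPreconnected I.1 := by
  obtain ⟨x, -, e⟩ := I.2
  rw [e]
  exact isPreconnected_connectedComponentIn

theorem gap_subset (I : gaps q Y) : I.1 ⊆ Set.Ioc q (sSup Y) \ Y := by
  obtain ⟨x, -, e⟩ := I.2
  rw [e]
  exact connectedComponentIn_subset _ _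

theorem gap_nonempty (I : gaps q Y) : I.1.Nonempty := by
  obtain ⟨x, hx, e⟩ := I.2
  rw [e]
  exact ⟨x, mem_connectedComponentIn hx⟩

theorem gap_eq_connectedComponentIn (I : gaps q Y) {x : ℝ} (hx : x ∈ I.1) :
    I.1 = connectedComponentIn (Set.Ioc q (sSup Y) \ Y) x := by
  obtain ⟨y, hy, e⟩ := I.2
  rw [e] at hx ⊢
  exact connectedComponentIn_eq hx

theorem gap_eq_of_mem {I J : gaps q Y} {x : ℝ} (hI : x ∈ I.1) (hJ : x ∈ J.1) : I = J :=
  Subtype.ext ((gap_eq_connectedComponentIn I hI).trans (gap_eq_connectedComponentIn J hJ).symm)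

theorem exists_gap_mem {x : ℝ} (hx : x ∈ Set.Ioc q (sSup Y) \ Y) : ∃ I : gaps q Y, x ∈ I.1 :=
  ⟨⟨_, x, hx, rfl⟩, mem_connectedComponentIn hx⟩

/-- A gap is not separated by a point of `Y`. -/
theorem gap_lt_imp_lt (I : gaps q Y) {x x' y : ℝ} (hx : x ∈ I.1) (hx' : x' ∈ I.1) (hy : y ∈ Y)
    (h : x < y) : x' < y := by
  by_contra! h'
  exact (gap_subset I ((isPreconnected_gap I).Icc_subset hx hx' ⟨h.le, h'⟩)).2 hy

theorem mem_gap_of_Icc_disjoint (I : gaps q Y) {x z : ℝ} (hx : x ∈ I.1) (hxz : x ≤ z)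
    (hz : z ≤ sSup Y) (hd : ∀ y ∈ Set.Icc x z, y ∉ Y) : z ∈ I.1 := by
  rw [gap_eq_connectedComponentIn I hx]
  refine isPreconnected_Icc.subset_connectedComponentIn (Set.left_mem_Icc.2 hxz) ?_
    (Set.right_mem_Icc.2 hxz)
  exact fun y hy => ⟨⟨(gap_subset I hx).1.1.trans_le hy.1, hy.2.trans hz⟩, hd y hy⟩

/-- The endpoint `sSup Y` belongs to `Y`, so removing `Y` from the half-open interval leaves an open
set. -/
theorem isOpen_gap (hne : Y.Nonempty) (hY : IsCompact Y) (I : gaps q Y) : IsOpen I.1 := by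
  obtain ⟨x, -, e⟩ := I.2
  have h : Set.Ioc q (sSup Y) \ Y = Set.Ioo q (sSup Y) \ Y := by
    ext z
    simp only [Set.mem_sdiff, Set.mem_Ioc, Set.mem_Ioo]
    refine ⟨fun h => ⟨⟨h.1.1, lt_of_le_of_ne h.1.2 ?_⟩, h.2⟩, fun h => ⟨⟨h.1.1, h.1.2.le⟩, h.2⟩⟩
    rintro rfl
    exact h.2 (hY.sSup_mem hne)
  rw [e, h]
  exact (isOpen_Ioo.sdiff hY.isClosed).connectedComponentIn

theorem countable_gaps (hne : Y.Nonempty) (hY : IsCompact Y) : Countable (gaps q Y) := by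
  have h : ∀ I : gaps q Y, ∃ r : ℚ, (r : ℝ) ∈ I.1 := fun I =>
    Rat.denseRange_cast.exists_mem_open (isOpen_gap hne hY I) (gap_nonempty I)
  choose r hr using h
  refine Function.Injective.countable (f := r) fun I J hIJ => gap_eq_of_mem (hr I) ?_
  rw [hIJ]
  exact hr J

/-- Points of `Y` which lie on the same side of all gaps lie in the same component. -/
theorem connectedComponents_eq_of_gaps (hq : ∀ y ∈ Y, q < y) (hY : IsCompact Y)
    (c : gaps q Y → ℝ) (hc : ∀ I, c I ∈ I.1) {y y' : Y} (hyy : y ≤ y')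
    (h : ∀ I, c I < y' → c I < y) :
    (ConnectedComponents.mk y : ConnectedComponents Y) = ConnectedComponents.mk y' := by
  have hsub : Set.Icc (y : ℝ) y' ⊆ Y := by
    intro z hz
    by_contra hzY
    have hyz : (y : ℝ) < z := lt_of_le_of_ne hz.1 fun e => hzY (e ▸ y.2)
    have hzy : z < y' := lt_of_le_of_ne hz.2 fun e => hzY (e ▸ y'.2)
    obtain ⟨I, hI⟩ := exists_gap_mem (q := q) (Y := Y) (x := z)
      ⟨⟨(hq y y.2).trans hyz, hzy.le.trans (le_csSup hY.bddAbove y'.2)⟩, hzY⟩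
    have h1 := gap_lt_imp_lt I (hc I) hI y.2 (h I (gap_lt_imp_lt I hI (hc I) y'.2 hzy))
    exact lt_asymm hyz h1
  have hle : (y : ℝ) ≤ y' := hyy
  have : PreconnectedSpace (Set.Icc (y : ℝ) y') := Subtype.preconnectedSpace isPreconnected_Icc
  have hr : IsPreconnected (Set.range (Set.inclusion hsub)) :=
    isPreconnected_range (continuous_inclusion hsub)
  rw [ConnectedComponents.coe_eq_coe']
  exact hr.subset_connectedComponent ⟨⟨y', Set.right_mem_Icc.2 hle⟩, rfl⟩
    ⟨⟨y, Set.left_mem_Icc.2 hle⟩, rfl⟩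

/-- A component is determined by the set of gaps to its left, and finitely many gaps have finitely
many subsets. -/
theorem infinite_gaps (hq : ∀ y ∈ Y, q < y) (hY : IsCompact Y)
    (h : Infinite (ConnectedComponents Y)) : Infinite (gaps q Y) := by
  by_contra hfin
  rw [not_infinite_iff_finite] at hfin
  choose c hc using gap_nonempty (q := q) (Y := Y)
  choose r hr using ConnectedComponents.surjective_coe (α := Y)
  let φ : ConnectedComponents Y → gaps q Y → Prop := fun C I => c I < r C
  have hφ : Function.Injective φ := by
    intro C C' hCC
    rw [← hr C, ← hr C']
    rcases le_total (r C) (r C') with hle | hle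
    · exact connectedComponents_eq_of_gaps hq hY c hc hle fun I hI =>
        (congrFun hCC I).mpr hI
    · exact (connectedComponents_eq_of_gaps hq hY c hc hle fun I hI =>
        (congrFun hCC I).mp hI).symm
  exact not_finite_iff_infinite.2 h (Finite.of_injective φ hφ)

end Gaps

/-! ### Step functions as a basis of `C(Y, ℤ)` -/

section Chi

variable {q : ℝ} {Y : Set ℝ}

theorem chi_apply {a b : ℝ} (ha : a ∉ Y) (hb : b ∉ Y) (y : Y) (hy : (y : ℝ) < b) :
    chi Y a b ha hb y = if a < y then 1 else 0 := by
  simp [chi, Set.indicator, hy]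

theorem K0.trace_chiClass {a b : ℝ} (ha : a ∉ Y) (hb : b ∉ Y) :
    K0.trace _ (chiClass Y a b ha hb) = chi Y a b ha hb := by
  rw [chiClass, K0.trace_mk]
  exact Matrix.trace_fin_one _

theorem linearIndependent_chi (hY : IsCompact Y) {b : ℝ} (hYb : ∀ y ∈ Y, y < b) (hb : b ∉ Y)
    (hne : Y.Nonempty) (c : gaps q Y → ℝ) (hc : ∀ I, c I ∈ I.1) :
    LinearIndependent ℤ fun I : gaps q Y => chi Y (c I) b (notMem_of_mem_gap I (hc I)) hb := by
  classical
  rw [linearIndependent_iff']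
  intro s g hsum
  by_contra! hex
  obtain ⟨i, his, hi⟩ := hex
  obtain ⟨j, hj, hmin⟩ := (s.filter fun i => g i ≠ 0).exists_min_image c
    ⟨i, Finset.mem_filter.2 ⟨his, hi⟩⟩
  rw [Finset.mem_filter] at hj
  -- At the first point `y` of `Y` after the leftmost `c j` with nonzero coefficient, only the term
  -- `j` survives: another `c i` before `y` would lie in the same gap as `c j`.
  obtain ⟨y, ⟨hyY, hy⟩, hleast⟩ := (hY.inter_right (isClosed_Ici (a := c j))).exists_isLeast
    ⟨sSup Y, hY.sSup_mem hne, (gap_subset j (hc j)).1.2⟩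
  have hcy : c j < y := lt_of_le_of_ne hy fun e => notMem_of_mem_gap j (hc j) (e ▸ hyY)
  have hval := DFunLike.congr_fun hsum ⟨y, hyY⟩
  rw [ContinuousMap.sum_apply, Finset.sum_eq_single j] at hval
  · rw [ContinuousMap.smul_apply, chi_apply _ _ _ (hYb y hyY), if_pos hcy] at hval
    simp at hval
    exact hj.2 hval
  · intro i his hij
    rw [ContinuousMap.smul_apply, chi_apply _ _ _ (hYb y hyY)]
    by_cases hgi : g i = 0
    · simp [hgi]
    rw [if_neg, smul_zero]
    intro hiy
    have hji := hmin i (Finset.mem_filter.2 ⟨his, hgi⟩)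
    refine hij (gap_eq_of_mem (hc i) (mem_gap_of_Icc_disjoint j (hc j) hji
      (gap_subset i (hc i)).1.2 fun z hz hzY => ?_))
    exact absurd (hleast ⟨hzY, hz.1⟩) (not_le.2 (hz.2.trans_lt hiy))
  · exact fun h => (h hj.1).elim

theorem chi_mem_span (hY : IsCompact Y) {b : ℝ} (hYb : ∀ y ∈ Y, y < b) (hb : b ∉ Y)
    (c : gaps q Y → ℝ) (hc : ∀ I, c I ∈ I.1) {z : ℝ} (hz : z ∉ Y) (hqz : q < z) :
    chi Y z b hz hb ∈ Submodule.span ℤ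
      (Set.range fun I : gaps q Y => chi Y (c I) b (notMem_of_mem_gap I (hc I)) hb) := by
  rcases le_or_gt z (sSup Y) with h | h
  · obtain ⟨I, hI⟩ := exists_gap_mem (q := q) (Y := Y) (x := z) ⟨⟨hqz, h⟩, hz⟩
    refine Submodule.subset_span ⟨I, ?_⟩
    ext y
    simp only [chi_apply _ _ y (hYb y y.2)]
    have : c I < y ↔ z < y := ⟨gap_lt_imp_lt I (hc I) hI y.2, gap_lt_imp_lt I hI (hc I) y.2⟩
    simp only [this]
  · have : chi Y z b hz hb = 0 := by
      ext y
      rw [chi_apply _ _ y (hYb y y.2), if_neg]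
      · rfl
      · exact not_lt.2 ((le_csSup hY.bddAbove y.2).trans h.le)
    rw [this]
    exact zero_mem _

theorem intCastHom_mem_span (hY : IsCompact Y) (hne : Y.Nonempty) (hq : ∀ y ∈ Y, q < y) {b : ℝ}
    (hYb : ∀ y ∈ Y, y < b) (hb : b ∉ Y) (c : gaps q Y → ℝ) (hc : ∀ I, c I ∈ I.1) (f : C(Y, ℤ)) :
    intCastHom Y f ∈ Submodule.span ℤ
      (Set.range fun I : gaps q Y => chi Y (c I) b (notMem_of_mem_gap I (hc I)) hb) := by
  set M := Submodule.span ℤ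
      (Set.range fun I : gaps q Y => chi Y (c I) b (notMem_of_mem_gap I (hc I)) hb)
  have : CompactSpace Y := isCompact_iff_compactSpace.mp hY
  -- Tolerance `1` suffices, since integers at distance less than `1` are equal.
  obtain ⟨δ, hδ, hf⟩ := Metric.uniformContinuous_iff.1
    (CompactSpace.uniformContinuous_of_continuous f.continuous) 1 one_pos
  have hloc : ∀ y y' : Y, |(y : ℝ) - y'| < δ → f y = f y' := by
    intro y y' h
    have := hf (show dist y y' < δ from h)
    rw [Int.dist_eq'] at this
    have h1 : |f y - f y'| < 1 := by exact_mod_cast this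
    rw [Int.abs_lt_one_iff] at h1
    exact sub_eq_zero.1 h1
  set d := δ / 2 with hd
  obtain ⟨x₀, hqx, hx₀⟩ := exists_between (hq _ (hY.sInf_mem hne))
  have hx₀' : ∀ y : Y, x₀ < y := fun y => hx₀.trans_le (csInf_le hY.bddBelow y.2)
  obtain ⟨N, hN⟩ := exists_nat_gt ((sSup Y - x₀) / d)
  rw [div_lt_iff₀ (by positivity)] at hN
  -- Here `k` counts the slabs left to clear: `g` vanishes up to the current cut and is constant at
  -- scale `δ` beyond it. For `k = 0` the cut is past `sSup Y`; for `k = N` it is `x₀`, left of `Y`.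
  have key : ∀ k ≤ N, ∀ g : C(Y, ℤ), (∀ y : Y, (y : ℝ) ≤ x₀ + (N - k : ℝ) * d → g y = 0) →
      (∀ y y' : Y, x₀ + (N - k : ℝ) * d ≤ y → x₀ + (N - k : ℝ) * d ≤ y' →
        |(y : ℝ) - y'| < δ → g y = g y') → intCastHom Y g ∈ M := by
    intro k
    induction k with
    | zero =>
      intro _ g hg _
      have : g = 0 := by
        ext y
        refine hg y ?_
        have := le_csSup hY.bddAbove y.2
        simp
        linarith
      rw [this, map_zero]
      exact zero_mem _
    | succ k ih =>
      intro hk g hg hgl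
      have hkN : ((k : ℝ) + 1) ≤ N := by exact_mod_cast hk
      set x := x₀ + (N - (k + 1 : ℕ) : ℝ) * d with hx
      have hx' : x₀ + (N - k : ℝ) * d = x + d := by rw [hx]; push_cast; ring
      have hqx' : q < x := by
        have : 0 ≤ (N - (k + 1 : ℕ) : ℝ) * d := by
          push_cast
          exact mul_nonneg (by linarith) (by positivity)
        linarith
      have ih := ih (by omega)
      rw [hx'] at ih
      by_cases hz : ∀ y : Y, (y : ℝ) ≤ x + d → g y = 0
      · exact ih g hz fun y y' h1 h2 => hgl y y' (by linarith) (by linarith)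
      · push Not at hz
        obtain ⟨y₁, hy₁, hgy₁⟩ := hz
        have hxy₁ : x < y₁ := by
          by_contra! h
          exact hgy₁ (hg y₁ h)
        have hstep : ∀ y : Y, x ≤ y → (y : ℝ) ≤ x + d → g y = g y₁ := fun y h1 h2 =>
          hgl y y₁ h1 hxy₁.le (by rw [abs_lt]; constructor <;> linarith)
        -- At a point `x` of `Y`, `g` would be both `0` and `g y₁`. So the jump falls off `Y`, and
        -- the step at `x` is continuous there.
        have hxY : x ∉ Y := fun h => hgy₁ (by
          rw [← hstep ⟨x, h⟩ le_rfl (by simp; positivity)]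
          exact hg ⟨x, h⟩ le_rfl)
        obtain ⟨e, he⟩ := mem_range_intCastHom (f := chi Y x b hxY hb) fun y => by
          rw [chi_apply _ _ y (hYb y y.2)]
          by_cases h : x < y
          · exact ⟨1, by simp [h]⟩
          · exact ⟨0, by simp [h]⟩
        have hey : ∀ y : Y, e y = if x < y then 1 else 0 := fun y => by
          have := DFunLike.congr_fun he y
          rw [chi_apply _ _ y (hYb y y.2), intCastHom_apply] at this
          split_ifs at this ⊢ <;> exact_mod_cast this
        -- Subtracting the jump clears this slab, and beyond it only changes `g` by a constant.
        have h1 : intCastHom Y (g - g y₁ • e) ∈ M := by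
          refine ih _ (fun y hy => ?_) fun y y' hy hy' hyy => ?_
          · rw [ContinuousMap.sub_apply, ContinuousMap.smul_apply, hey]
            by_cases h : x < y
            · simp [h, hstep y h.le hy]
            · simp [h, hg y (not_lt.1 h)]
          · have h2 : x < y := by linarith
            have h3 : x < y' := by linarith
            simp [hey, h2, h3, hgl y y' h2.le h3.le hyy]
        rw [map_sub, map_zsmul, he] at h1
        have h2 := Submodule.smul_mem M (g y₁) (chi_mem_span hY hYb hb c hc hxY hqx')
        simpa using add_mem h1 h2
  refine key N le_rfl f (fun y hy => ?_) fun y y' _ _ => hloc y y'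
  simp at hy
  exact absurd (hx₀' y) (not_lt.2 hy)

end Chi

/-! ### Transfer to `K₀` along the trace -/

section Main

variable {q b : ℝ} {Y : Set ℝ}

theorem span_chiClass (hY : IsCompact Y) (hne : Y.Nonempty) (hq : ∀ y ∈ Y, q < y)
    (hYb : ∀ y ∈ Y, y < b) (hb : b ∉ Y) (c : gaps q Y → ℝ) (hc : ∀ I, c I ∈ I.1) :
    Submodule.span ℤ (Set.range fun I : gaps q Y =>
      chiClass Y (c I) b (notMem_of_mem_gap I (hc I)) hb) = ⊤ := by
  refine eq_top_iff.2 fun x _ => ?_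
  obtain ⟨f, hf⟩ := K0.trace_mem_range_intCastHom x
  have h := intCastHom_mem_span hY hne hq hYb hb c hc f
  have hr : (Set.range fun I : gaps q Y => chi Y (c I) b (notMem_of_mem_gap I (hc I)) hb) =
      (K0.trace C(Y, ℂ)).toIntLinearMap '' Set.range fun I : gaps q Y =>
        chiClass Y (c I) b (notMem_of_mem_gap I (hc I)) hb := by
    rw [← Set.range_comp]
    exact congrArg Set.range (funext fun I => (K0.trace_chiClass _ _).symm)
  rw [hf, hr, Submodule.span_image] at h
  obtain ⟨z, hz, hzx⟩ := h
  rwa [← K0.trace_injective hY hzx]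

theorem linearIndependent_chiClass (hY : IsCompact Y) (hne : Y.Nonempty)
    (hYb : ∀ y ∈ Y, y < b) (hb : b ∉ Y) (c : gaps q Y → ℝ) (hc : ∀ I, c I ∈ I.1) :
    LinearIndependent ℤ fun I : gaps q Y =>
      chiClass Y (c I) b (notMem_of_mem_gap I (hc I)) hb := by
  refine LinearIndependent.of_comp (K0.trace C(Y, ℂ)).toIntLinearMap ?_
  convert! linearIndependent_chi hY hYb hb hne c hc using 2 with I
  exact K0.trace_chiClass _ _

theorem range_trace_eq (hY : IsCompact Y) (hne : Y.Nonempty) :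
    (K0.trace C(Y, ℂ)).range = (intCastHom Y).range := by
  refine le_antisymm ?_ ?_
  · rintro _ ⟨x, rfl⟩
    exact K0.trace_mem_range_intCastHom x
  · rintro _ ⟨f, rfl⟩
    obtain ⟨a, ha⟩ := hY.bddBelow
    obtain ⟨b, hb⟩ := hY.bddAbove
    -- Any bounds strictly outside `Y` may play the roles of `q` and `1`.
    choose c hc using gap_nonempty (q := a - 1) (Y := Y)
    have hYb : ∀ y ∈ Y, y < b + 1 := fun y hy => by linarith [hb hy]
    have h := intCastHom_mem_span hY hne (fun y hy => by linarith [ha hy]) hYb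
      (fun h => lt_irrefl _ (hYb _ h)) c hc f
    suffices hs : Submodule.span ℤ _ ≤ AddSubgroup.toIntSubmodule (K0.trace C(Y, ℂ)).range from hs h
    rw [Submodule.span_le]
    rintro _ ⟨I, rfl⟩
    exact ⟨_, K0.trace_chiClass _ _⟩

/-- `K₀(C(Y))` is the group of continuous functions `Y → ℤ`. -/
noncomputable def K0.equivInt (hY : IsCompact Y) (hne : Y.Nonempty) :
    K0 C(Y, ℂ) ≃+ C(Y, ℤ) :=
  ((AddMonoidHom.ofInjective (K0.trace_injective hY)).trans
    (AddEquiv.addSubgroupCongr (range_trace_eq hY hne))).trans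
    (AddMonoidHom.ofInjective intCastHom_injective).symm

end Main

end KTheory

theorem proposition3p4 (q : ℝ) (hq0 : 0 < q) (hq1 : q < 1) (Y : Set ℝ) (hne : Y.Nonempty)
    (hcpt : IsCompact Y) (hY : Y ⊆ Set.Ioo q 1) :
    Subsingleton (KTheory.K1 C(Y, ℂ)) ∧
    (∀ n : ℕ, ENat.card (ConnectedComponents Y) = n →
      Nonempty (KTheory.K0 C(Y, ℂ) ≃+ (Fin n → ℤ))) ∧
    (Infinite (ConnectedComponents Y) → Nonempty (KTheory.K0 C(Y, ℂ) ≃+ (ℕ →₀ ℤ))) ∧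
    (∀ (c : KTheory.gaps q Y → ℝ) (hc : ∀ I, c I ∈ I.1),
      LinearIndependent ℤ (fun I : KTheory.gaps q Y =>
        KTheory.chiClass Y (c I) 1 (KTheory.notMem_of_mem_gap I (hc I))
          (fun h => lt_irrefl 1 (hY h).2)) ∧
      Submodule.span ℤ (Set.range fun I : KTheory.gaps q Y =>
        KTheory.chiClass Y (c I) 1 (KTheory.notMem_of_mem_gap I (hc I))
          (fun h => lt_irrefl 1 (hY h).2)) = ⊤) := by
  have hq : ∀ y ∈ Y, q < y := fun y hy => (hY hy).1
  have hYb : ∀ y ∈ Y, y < 1 := fun y hy => (hY hy).2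
  have hb : (1 : ℝ) ∉ Y := fun h => lt_irrefl 1 (hY h).2
  refine ⟨KTheory.subsingleton_K1 hcpt, fun n hn => ?_, fun hinf => ?_, fun c hc =>
    ⟨KTheory.linearIndependent_chiClass hcpt hne hYb hb c hc,
      KTheory.span_chiClass hcpt hne hq hYb hb c hc⟩⟩
  · have hfin : Finite (ConnectedComponents Y) := by
      rw [← ENat.card_lt_top, hn]
      exact ENat.natCast_lt_top n
    have hcard : Nat.card (ConnectedComponents Y) = n := by
      rw [ENat.card_eq_coe_natCard] at hn
      exact_mod_cast hn
    let e := Finite.equivFinOfCardEq hcard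
    exact ⟨((KTheory.K0.equivInt hcpt hne).trans
      (KTheory.connectedComponentsEquiv Y).symm).trans
      (AddEquiv.arrowCongr e (AddEquiv.refl ℤ))⟩
  · have h1 := KTheory.infinite_gaps (q := q) hq hcpt hinf
    have h2 := KTheory.countable_gaps (q := q) hne hcpt
    obtain ⟨e⟩ := nonempty_denumerable (KTheory.gaps q Y)
    choose c hc using KTheory.gap_nonempty (q := q) (Y := Y)
    let B := Module.Basis.mk (KTheory.linearIndependent_chiClass hcpt hne hYb hb c hc)
      (KTheory.span_chiClass hcpt hne hq hYb hb c hc).ge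
    exact ⟨(B.reindex (Denumerable.eqv (KTheory.gaps q Y))).repr.toAddEquiv⟩
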